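/- A finite hypergraph $\mathcal H$ with an ordered vertex set is \emph{ABA-free} if there are no two hyperedges $A,B$ and vertices $x<y<z$ with $x,z\in A\setminus B$ and $y\in B\setminus A$; a hypergraph with an unordered vertex set is ABA-free if its vertices have an ordering with which it is ABA-free. A \emph{graphic pseudoline arrangement} is a finite set of curves in the plane, each of them the graph of a continuous function $\mathbb R\to\mathbb R$, such that any two of the curves are either disjoint or meet in exactly one point, at which they cross, and no three of the curves have a common point. Let $S$ be a finite set of points in the plane with pairwise different $x$-coordinates and let $L$ be a graphic pseudoline arrangement. Let $\mathcal H_{S,L}$ be the hypergraph with vertex set $S$ whose hyperedges are the sets $\{p\in S: p \text{ lies strictly above } \ell\}$ for $\ell\in L$. Then $\mathcal H_{S,L}$ is ABA-free with the order on the vertices defined by the $x$-coordinates. Conversely, given a finite ABA-free hypergraph $\mathcal H$, there exist a finite set $S$ of points in the plane with pairwise different $x$-coordinates and a graphic pseudoline arrangement $L$ such that $\mathcal H=\mathcal H_{S,L}$ up to renaming the vertices; moreover, for any ordering of the vertices with which $\mathcal H$ is ABA-free, $S$ and $L$ can be chosen so that the identification of the vertices of $\mathcal H$ with the points of $S$ carries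 this ordering to the order by $x$-coordinates. -/

import Mathlib

open Set Filter Topology

universe u

/-- The hypergraph `H`, with its vertex set ordered by `r`, is ABA-free: `r` is a strict total
order on the vertices, and there are no two hyperedges `A`, `B` and vertices `x < y < z` with
`x, z ∈ A \ B` and `y ∈ B \ A`. -/
structure Hypergraph.IsABAFree {α : Type u} (H : Hypergraph α) (r : α → α → Prop) : Prop where
  isStrictTotalOrder : IsStrictTotalOrder H.vertexSet (Subrel r (· ∈ H.vertexSet))
  not_aba : ∀ A ∈ H.edgeSet, ∀ B ∈ H.edgeSet,
    ∀ x ∈ H.vertexSet, ∀ y ∈ H.vertexSet, ∀ z ∈ H.vertexSet, r x y → r y z →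
      ¬ (x ∈ A \ B ∧ y ∈ B \ A ∧ z ∈ A \ B)

/-- At their common point with abscissa `x`, the graph of `f` passes from below to above the
graph of `g`. -/
def CrossesUpAt (f g : ℝ → ℝ) (x : ℝ) : Prop :=
  f x = g x ∧ (∀ᶠ t in 𝓝[<] x, f t < g t) ∧ (∀ᶠ t in 𝓝[>] x, g t < f t)

/-- The graphs of `f` and `g` meet at abscissa `x`, and they cross there. -/
def CrossesAt (f g : ℝ → ℝ) (x : ℝ) : Prop :=
  CrossesUpAt f g x ∨ CrossesUpAt g f x

/-- A graphic pseudoline arrangement: a finite set of curves, each the graph of a continuous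
function `ℝ → ℝ`, such that any two are disjoint or have exactly one common point, at which they
cross, and such that no three have a common point. -/
structure IsGraphicPseudolineArrangement (L : Set C(ℝ, ℝ)) : Prop where
  finite : L.Finite
  disjoint_or_cross : ∀ f ∈ L, ∀ g ∈ L, f ≠ g →
    (∀ x, f x ≠ g x) ∨ ∃ x, CrossesAt f g x ∧ ∀ t, f t = g t → t = x
  general_position : ∀ f ∈ L, ∀ g ∈ L, ∀ h ∈ L, f ≠ g → g ≠ h → f ≠ h →
    ∀ x, ¬ (f x = g x ∧ g x = h x)

/-- The points of `S` above the graph of `l`. -/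
def pointsAbove (S : Set (ℝ × ℝ)) (l : C(ℝ, ℝ)) : Set (ℝ × ℝ) :=
  {p | p ∈ S ∧ l p.1 < p.2}

/-- The hypergraph with vertex set `S` whose hyperedges are the sets of points of `S` above the
curves of `L`. -/
def aboveHypergraph (S : Set (ℝ × ℝ)) (L : Set C(ℝ, ℝ)) : Hypergraph (ℝ × ℝ) where
  vertexSet := S
  edgeSet := {e | ∃ l ∈ L, e = pointsAbove S l}
  subset_vertexSet_of_mem_edgeSet' := by
    rintro e ⟨l, -, rfl⟩ p hp
    exact hp.1

/-! In the forward direction, an ABA pattern makes the difference of two curves change sign twice,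
so the curves meet twice. For the converse, rank the vertices and place rank `i` at `(i, -1)`. A
hyperedge `A` gets the curve `-∑ j ∈ A, c j * exp (-lam * (x - j) ^ 2)` with `1 < c j < 2`. For
large `lam` it dips below height `-1` at the integers in `A` and at no others
(`bumpCurve_natCast_lt_neg_one_iff`). Up to a common positive factor, such a curve is a polynomial
in `T = exp (2 * lam * x)` with coefficients `-d j`, where `d j = c j * exp (-lam * j ^ 2)`.
ABA-freeness says that the coefficients of the difference of two of them change sign at most once.
As in Descartes' rule, there is at most one positive root, and the sign changes there
(`sum_mul_pow_lt_sum_mul_pow_of_separated`). Choosing the `d j` generically excludes triple points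
(`exists_coeff_subsums_generic`). -/

/-! ### Generic coefficients. -/

/-- Generically chosen positive coefficients: no three different subsums of `∑ j < n, d j * T ^ j`
agree at a positive `T`. -/
theorem exists_coeff_subsums_generic (a b : ℕ → ℝ) (ha : ∀ j, 0 ≤ a j) (hab : ∀ j, a j < b j)
    (n : ℕ) :
    ∃ d : ℕ → ℝ, (∀ j, d j ∈ Ioo (a j) (b j)) ∧
      ∀ A B C : Finset ℕ, A ⊆ Finset.range n → B ⊆ Finset.range n → C ⊆ Finset.range n →
        ∀ T : ℝ, 0 < T → ∑ j ∈ A, d j * T ^ j = ∑ j ∈ B, d j * T ^ j →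
          ∑ j ∈ B, d j * T ^ j = ∑ j ∈ C, d j * T ^ j → A = B ∨ B = C ∨ A = C := by
  induction n with
  | zero =>
    choose d hd using fun j => exists_between (hab j)
    refine ⟨d, hd, fun A B C hA hB _ _ _ _ _ => Or.inl ?_⟩
    simp only [Finset.range_zero, Finset.subset_empty] at hA hB
    rw [hA, hB]
  | succ n ih =>
    obtain ⟨d, hd, hgen⟩ := ih
    have hpos : ∀ j, 0 < d j := fun j => (ha j).trans_lt (hd j).1
    set G : Finset ℕ → ℝ → ℝ := fun A T => ∑ j ∈ A, d j * T ^ j with hG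
    -- The values of the new coefficient for which a third curve passes through a meeting point of
    -- two distinct old ones. There are countably many, as distinct polynomials agree at finitely
    -- many points.
    set bad : Set ℝ := ⋃ A : Finset ℕ, ⋃ B : Finset ℕ, ⋃ C : Finset ℕ, ⋃ _ : B ≠ C,
      (fun T => |G A T - G B T| / T ^ n) '' {T | G B T = G C T} with hbad
    have hroots : ∀ B C : Finset ℕ, B ≠ C → {T | G B T = G C T}.Finite := by
      intro B C hBC
      set P : Finset ℕ → Polynomial ℝ := fun A => ∑ j ∈ A, Polynomial.monomial j (d j) with hP
      have hcoeff : ∀ A j, (P A).coeff j = if j ∈ A then d j else 0 := by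
        intro A j
        simp [hP, Polynomial.coeff_monomial]
      have hne : P B - P C ≠ 0 := by
        intro h
        apply hBC
        ext j
        have hj : (P B).coeff j = (P C).coeff j := by rw [sub_eq_zero.1 h]
        rw [hcoeff, hcoeff] at hj
        have := (hpos j).ne'
        by_cases h1 : j ∈ B <;> by_cases h2 : j ∈ C <;> simp_all
      refine (Polynomial.finite_setOfPred_isRoot hne).subset fun T hT => ?_
      have hev : ∀ A, (P A).eval T = G A T := by
        intro A
        simp [hP, hG, Polynomial.eval_finsetSum]
      simp only [mem_ofPred_eq, Polynomial.IsRoot, Polynomial.eval_sub, hev] at hT ⊢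
      rw [hT, sub_self]
    have hcount : bad.Countable :=
      countable_iUnion fun A => countable_iUnion fun B => countable_iUnion fun C =>
        countable_iUnion fun h => ((hroots B C h).image _).countable
    obtain ⟨c, hc, hcbad⟩ : ∃ c ∈ Ioo (a n) (b n), c ∉ bad := by
      by_contra! h
      have := (hcount.mono h).measure_zero MeasureTheory.volume
      rw [Real.volume_Ioo, ENNReal.ofReal_eq_zero] at this
      linarith [hab n]
    have hc0 : 0 < c := (ha n).trans_lt hc.1
    have hsum : ∀ (A : Finset ℕ) (T : ℝ), ∑ j ∈ A, Function.update d n c j * T ^ j =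
        G (A.erase n) T + if n ∈ A then c * T ^ n else 0 := by
      intro A T
      have herase : ∑ j ∈ A.erase n, Function.update d n c j * T ^ j = G (A.erase n) T :=
        Finset.sum_congr rfl fun j hj => by
          rw [Function.update_of_ne (Finset.ne_of_mem_erase hj)]
      split_ifs with h
      · rw [← Finset.sum_erase_add _ _ h, herase, Function.update_self]
      · rw [← herase, Finset.erase_eq_of_notMem h, add_zero]
    have herase_inj : ∀ A B : Finset ℕ, (n ∈ A ↔ n ∈ B) → A.erase n = B.erase n → A = B := by
      intro A B h hAB
      ext j
      rcases eq_or_ne j n with rfl | hj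
      · exact h
      · have := congrArg (j ∈ ·) hAB
        simpa [hj] using this
    have hsub : ∀ A : Finset ℕ, A ⊆ Finset.range (n + 1) → A.erase n ⊆ Finset.range n := by
      intro A hA j hj
      have h1 := Finset.mem_range.1 (hA (Finset.mem_of_mem_erase hj))
      have h2 := Finset.ne_of_mem_erase hj
      exact Finset.mem_range.2 (by omega)
    have hodd : ∀ (A B C : Finset ℕ) (T : ℝ), 0 < T → (n ∈ B ↔ n ∈ C) → ¬ (n ∈ A ↔ n ∈ B) →
        ∑ j ∈ A, Function.update d n c j * T ^ j = ∑ j ∈ B, Function.update d n c j * T ^ j →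
        ∑ j ∈ B, Function.update d n c j * T ^ j = ∑ j ∈ C, Function.update d n c j * T ^ j →
        B = C := by
      intro A B C T hT hBC hAB h1 h2
      by_contra hne
      apply hcbad
      rw [hsum, hsum] at h1 h2
      have h2' : G (B.erase n) T = G (C.erase n) T := by
        simp only [hBC] at h2
        exact add_right_cancel h2
      simp only [hbad, mem_iUnion]
      refine ⟨A.erase n, B.erase n, C.erase n, fun h => hne (herase_inj _ _ hBC h), T, h2', ?_⟩
      have hTn : 0 < T ^ n := pow_pos hT n
      have habs : |G (A.erase n) T - G (B.erase n) T| = c * T ^ n := by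
        rw [← abs_of_pos (mul_pos hc0 hTn)]
        by_cases hA : n ∈ A
        · have hB : n ∉ B := fun h => hAB ⟨fun _ => h, fun _ => hA⟩
          rw [if_pos hA, if_neg hB] at h1
          rw [abs_sub_comm]
          congr 1
          linarith
        · have hB : n ∈ B := by tauto
          rw [if_neg hA, if_pos hB] at h1
          congr 1
          linarith
      simp only [habs]
      field_simp
    refine ⟨Function.update d n c, fun j => ?_, fun A B C hA hB hC T hT h1 h2 => ?_⟩
    · rcases eq_or_ne j n with rfl | hj
      · rwa [Function.update_self]
      · rw [Function.update_of_ne hj]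
        exact hd j
    -- Two of the three sets agree on containing `n`. If all agree, the top term cancels and
    -- induction applies; otherwise `hodd` does.
    · by_cases hAB : n ∈ A ↔ n ∈ B
      · by_cases hBC : n ∈ B ↔ n ∈ C
        · rw [hsum, hsum] at h1 h2
          simp only [hAB, hBC] at h1 h2
          rcases hgen _ _ _ (hsub A hA) (hsub B hB) (hsub C hC) T hT (add_right_cancel h1)
            (add_right_cancel h2) with h | h | h
          · exact Or.inl (herase_inj _ _ hAB h)
          · exact Or.inr (Or.inl (herase_inj _ _ hBC h))
          · exact Or.inr (Or.inr (herase_inj _ _ (hAB.trans hBC) h))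
        · exact Or.inl (hodd C A B T hT hAB (by tauto) (h1.trans h2).symm h1)
      · by_cases hBC : n ∈ B ↔ n ∈ C
        · exact Or.inr (Or.inl (hodd A B C T hT hBC hAB h1 h2))
        · exact Or.inr (Or.inr (hodd B A C T hT (by tauto) (by tauto) h1.symm (h1.trans h2)))

/-! ### Sums with one sign change. -/

/-- If all of `A \ B` lies before all of `B \ A`, then the sum over `B` outgrows the one over `A`. -/
theorem sum_mul_pow_lt_sum_mul_pow_of_separated {d : ℕ → ℝ} (hd : ∀ j, 0 < d j) {A B : Finset ℕ}
    (hne : A ≠ B) (hsep : ∀ i ∈ A \ B, ∀ j ∈ B \ A, i < j) {T T' : ℝ} (hT : 0 < T) (hTT' : T < T')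
    (hle : ∑ j ∈ A, d j * T ^ j ≤ ∑ j ∈ B, d j * T ^ j) :
    ∑ j ∈ A, d j * T' ^ j < ∑ j ∈ B, d j * T' ^ j := by
  have hT' : 0 < T' := hT.trans hTT'
  rw [← Finset.sum_sdiff_le_sum_sdiff] at hle
  rw [← Finset.sum_sdiff_lt_sum_sdiff]
  have hterm : ∀ {t : ℝ}, 0 < t → ∀ j, 0 < d j * t ^ j := fun ht j =>
    mul_pos (hd j) (pow_pos ht j)
  have hBA : (B \ A).Nonempty := by
    by_contra h
    rw [Finset.not_nonempty_iff_eq_empty] at h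
    rw [h, Finset.sum_empty] at hle
    refine hne (Finset.Subset.antisymm (Finset.sdiff_eq_empty_iff_subset.1 ?_)
      (Finset.sdiff_eq_empty_iff_subset.1 h))
    by_contra h'
    exact hle.not_gt (Finset.sum_pos (fun j _ => hterm hT j) (Finset.nonempty_iff_ne_empty.2 h'))
  rcases (A \ B).eq_empty_or_nonempty with hAB | hAB
  · rw [hAB, Finset.sum_empty]
    exact Finset.sum_pos (fun j _ => hterm hT' j) hBA
  -- Replacing `T` by `s * T` multiplies term `j` by `s ^ j`: less than `s ^ k` on `A \ B`, at least
  -- `s ^ k` on `B \ A`.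
  set k := (B \ A).min' hBA
  set s := T' / T
  have hs : 1 < s := (one_lt_div hT).2 hTT'
  have hsT : ∀ j, d j * T' ^ j = s ^ j * (d j * T ^ j) := by
    intro j
    have : T' = s * T := by simp only [s]; field_simp
    rw [this, mul_pow]
    ring
  calc ∑ j ∈ A \ B, d j * T' ^ j < ∑ j ∈ A \ B, s ^ k * (d j * T ^ j) := by
        refine Finset.sum_lt_sum_of_nonempty hAB fun j hj => ?_
        rw [hsT]
        exact mul_lt_mul_of_pos_right
          (pow_lt_pow_right₀ hs (hsep j hj k (Finset.min'_mem _ _))) (hterm hT j)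
    _ = s ^ k * ∑ j ∈ A \ B, d j * T ^ j := (Finset.mul_sum _ _ _).symm
    _ ≤ s ^ k * ∑ j ∈ B \ A, d j * T ^ j := by gcongr
    _ = ∑ j ∈ B \ A, s ^ k * (d j * T ^ j) := Finset.mul_sum _ _ _
    _ ≤ ∑ j ∈ B \ A, d j * T' ^ j := by
        refine Finset.sum_le_sum fun j hj => ?_
        rw [hsT]
        exact mul_le_mul_of_nonneg_right
          (pow_le_pow_right₀ hs.le (Finset.min'_le _ _ hj)) (hterm hT j).le

/-! ### Bump curves. -/

/-- The graph of minus a sum of Gaussian bumps, one for each element of `A`. -/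
noncomputable def bumpCurve (lam : ℝ) (d : ℕ → ℝ) (A : Finset ℕ) : C(ℝ, ℝ) where
  toFun x := -(Real.exp (-(lam * x ^ 2)) * ∑ j ∈ A, d j * Real.exp (2 * lam * x) ^ j)
  continuous_toFun := by fun_prop

theorem bumpCurve_apply (lam : ℝ) (d : ℕ → ℝ) (A : Finset ℕ) (x : ℝ) :
    bumpCurve lam d A x =
      -(Real.exp (-(lam * x ^ 2)) * ∑ j ∈ A, d j * Real.exp (2 * lam * x) ^ j) := rfl

theorem bumpCurve_lt_iff (lam : ℝ) (d : ℕ → ℝ) (A B : Finset ℕ) (x : ℝ) :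
    bumpCurve lam d A x < bumpCurve lam d B x ↔
      ∑ j ∈ B, d j * Real.exp (2 * lam * x) ^ j < ∑ j ∈ A, d j * Real.exp (2 * lam * x) ^ j := by
  rw [bumpCurve_apply, bumpCurve_apply, neg_lt_neg_iff, mul_lt_mul_iff_right₀ (Real.exp_pos _)]

theorem bumpCurve_eq_iff (lam : ℝ) (d : ℕ → ℝ) (A B : Finset ℕ) (x : ℝ) :
    bumpCurve lam d A x = bumpCurve lam d B x ↔
      ∑ j ∈ A, d j * Real.exp (2 * lam * x) ^ j = ∑ j ∈ B, d j * Real.exp (2 * lam * x) ^ j := by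
  rw [bumpCurve_apply, bumpCurve_apply, neg_inj, mul_right_inj' (Real.exp_pos _).ne']

theorem bumpCurve_crossesUpAt {lam : ℝ} (hlam : 0 < lam) {d : ℕ → ℝ} (hd : ∀ j, 0 < d j)
    {A B : Finset ℕ} (hne : A ≠ B) (hsep : ∀ i ∈ A \ B, ∀ j ∈ B \ A, i < j) {x : ℝ}
    (hx : bumpCurve lam d A x = bumpCurve lam d B x) :
    CrossesUpAt (bumpCurve lam d A) (bumpCurve lam d B) x ∧
      ∀ t, bumpCurve lam d A t = bumpCurve lam d B t → t = x := by
  have hexp : ∀ {s t : ℝ}, s < t → Real.exp (2 * lam * s) < Real.exp (2 * lam * t) := fun h =>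
    Real.exp_lt_exp.2 (mul_lt_mul_of_pos_left h (by positivity))
  have hx' := (bumpCurve_eq_iff ..).1 hx
  have hleft : ∀ t < x, bumpCurve lam d A t < bumpCurve lam d B t := by
    intro t ht
    rw [bumpCurve_lt_iff]
    by_contra! h
    exact (sum_mul_pow_lt_sum_mul_pow_of_separated hd hne hsep (Real.exp_pos _) (hexp ht) h).ne hx'
  have hright : ∀ t > x, bumpCurve lam d B t < bumpCurve lam d A t := by
    intro t ht
    rw [bumpCurve_lt_iff]
    exact sum_mul_pow_lt_sum_mul_pow_of_separated hd hne hsep (Real.exp_pos _) (hexp ht) hx'.le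
  refine ⟨⟨hx, ?_, ?_⟩, fun t ht => ?_⟩
  · filter_upwards [self_mem_nhdsWithin] with t ht using hleft t ht
  · filter_upwards [self_mem_nhdsWithin] with t ht using hright t ht
  · rcases lt_trichotomy t x with h | h | h
    · exact absurd ht (hleft t h).ne
    · exact h
    · exact absurd ht (hright t h).ne'

theorem bumpCurve_disjoint_or_cross {lam : ℝ} (hlam : 0 < lam) {d : ℕ → ℝ} (hd : ∀ j, 0 < d j)
    {A B : Finset ℕ} (hne : A ≠ B)
    (hsep : (∀ i ∈ A \ B, ∀ j ∈ B \ A, i < j) ∨ (∀ i ∈ B \ A, ∀ j ∈ A \ B, i < j)) :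
    (∀ x, bumpCurve lam d A x ≠ bumpCurve lam d B x) ∨
      ∃ x, CrossesAt (bumpCurve lam d A) (bumpCurve lam d B) x ∧
        ∀ t, bumpCurve lam d A t = bumpCurve lam d B t → t = x := by
  by_cases h : ∃ x, bumpCurve lam d A x = bumpCurve lam d B x
  · obtain ⟨x, hx⟩ := h
    refine Or.inr ⟨x, ?_⟩
    rcases hsep with hsep | hsep
    · obtain ⟨h1, h2⟩ := bumpCurve_crossesUpAt hlam hd hne hsep hx
      exact ⟨Or.inl h1, h2⟩
    · obtain ⟨h1, h2⟩ := bumpCurve_crossesUpAt hlam hd hne.symm hsep hx.symm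
      exact ⟨Or.inr h1, fun t ht => h2 t ht.symm⟩
  · exact Or.inl (not_exists.1 h)

/-- Two sets without an `ABA` or `BAB` pattern differ in two separated blocks. -/
theorem Finset.sdiff_separated_of_not_aba {A B : Finset ℕ}
    (hA : ∀ x y z, x < y → y < z → ¬ (x ∈ A \ B ∧ y ∈ B \ A ∧ z ∈ A \ B))
    (hB : ∀ x y z, x < y → y < z → ¬ (x ∈ B \ A ∧ y ∈ A \ B ∧ z ∈ B \ A)) :
    (∀ i ∈ A \ B, ∀ j ∈ B \ A, i < j) ∨ (∀ i ∈ B \ A, ∀ j ∈ A \ B, i < j) := by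
  have hne : ∀ i ∈ A \ B, ∀ j ∈ B \ A, i ≠ j := by
    rintro i hi j hj rfl
    exact (Finset.mem_sdiff.1 hi).2 (Finset.mem_sdiff.1 hj).1
  by_contra! h
  obtain ⟨⟨i, hi, j, hj, hij⟩, j', hj', i', hi', hij'⟩ := h
  have h1 := hne i hi j hj
  have h2 := hne i' hi' j' hj'
  -- Here `j < i` and `i' < j'`, so either `i' < j < i` or `j < i' < j'` is a forbidden pattern.
  rcases lt_or_gt_of_ne (hne i' hi' j hj) with h | h
  · exact hA i' j i h (by omega) ⟨hi', hj, hi⟩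
  · exact hB j i' j' h (by omega) ⟨hj, hi', hj'⟩

/-- At its own centre a bump exceeds `1`. At any other integer it is at most `2 * exp (-lam)`, and
`lam = 2 * n + 1` makes `n` such tails sum to at most `1`. -/
theorem bumpCurve_natCast_lt_neg_one_iff {n : ℕ} {d : ℕ → ℝ}
    (hd : ∀ j : ℕ, d j ∈ Ioo (Real.exp (-((2 * n + 1 : ℝ) * j ^ 2)))
      (2 * Real.exp (-((2 * n + 1 : ℝ) * j ^ 2))))
    {A : Finset ℕ} (hA : A ⊆ Finset.range n) (i : ℕ) :
    bumpCurve (2 * n + 1) d A i < -1 ↔ i ∈ A := by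
  set lam : ℝ := 2 * n + 1
  have hlam0 : 0 < lam := by positivity
  set g : ℕ → ℝ := fun j => Real.exp (-(lam * (i : ℝ) ^ 2)) * (d j * Real.exp (2 * lam * i) ^ j)
  have hexp : ∀ j : ℕ, Real.exp (-(lam * (i : ℝ) ^ 2)) *
      (Real.exp (-(lam * (j : ℝ) ^ 2)) * Real.exp (2 * lam * i) ^ j) =
        Real.exp (-(lam * ((i : ℝ) - j) ^ 2)) := by
    intro j
    rw [← Real.exp_nat_mul, ← Real.exp_add, ← Real.exp_add]
    congr 1
    ring
  have hlow : ∀ j : ℕ, Real.exp (-(lam * ((i : ℝ) - j) ^ 2)) < g j := by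
    intro j
    rw [← hexp]
    have := (hd j).1
    simp only [g]
    gcongr
  have hup : ∀ j : ℕ, g j ≤ 2 * Real.exp (-(lam * ((i : ℝ) - j) ^ 2)) := by
    intro j
    calc g j ≤ Real.exp (-(lam * (i : ℝ) ^ 2)) *
          (2 * Real.exp (-(lam * (j : ℝ) ^ 2)) * Real.exp (2 * lam * i) ^ j) := by
          have := (hd j).2
          simp only [g]
          gcongr
      _ = _ := by rw [← hexp]; ring
  have hval : bumpCurve lam d A i = -∑ j ∈ A, g j := by
    rw [bumpCurve_apply, Finset.mul_sum]
  rw [hval, neg_lt_neg_iff]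
  constructor
  · intro h
    by_contra hi
    refine h.not_ge ?_
    have hterm : ∀ j ∈ A, g j ≤ 2 * Real.exp (-lam) := by
      intro j hj
      refine (hup j).trans ?_
      have hij : (1 : ℝ) ≤ ((i : ℝ) - j) ^ 2 := by
        have hne : (i : ℤ) - j ≠ 0 := by
          intro h0
          exact hi ((by omega : i = j) ▸ hj)
        have h1 : (1 : ℤ) ≤ ((i : ℤ) - j) ^ 2 := Int.add_one_le_iff.2 (sq_pos_of_ne_zero hne)
        exact_mod_cast h1
      gcongr
      nlinarith
    have hcard : (A.card : ℝ) ≤ n := by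
      exact_mod_cast (Finset.card_le_card hA).trans_eq (Finset.card_range n)
    calc ∑ j ∈ A, g j ≤ A.card • (2 * Real.exp (-lam)) := Finset.sum_le_card_nsmul _ _ _ hterm
      _ ≤ n * (2 * Real.exp (-lam)) := by rw [nsmul_eq_mul]; gcongr
      _ = 2 * n / Real.exp lam := by rw [Real.exp_neg]; ring
      _ ≤ 1 := by
        rw [div_le_one (Real.exp_pos _)]
        linarith [Real.add_one_le_exp lam]
  · intro hi
    calc (1 : ℝ) = Real.exp (-(lam * ((i : ℝ) - i) ^ 2)) := by simp
      _ < g i := hlow i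
      _ ≤ ∑ j ∈ A, g j := Finset.single_le_sum
          (fun j _ => (Real.exp_pos _).le.trans (hlow j).le) hi

/-! ### From arrangements to ABA-free hypergraphs. -/

theorem aboveHypergraph_isABAFree {S : Set (ℝ × ℝ)} {L : Set C(ℝ, ℝ)} (hS : InjOn Prod.fst S)
    (hL : IsGraphicPseudolineArrangement L) :
    (aboveHypergraph S L).IsABAFree (fun p q => p.1 < q.1) where
  isStrictTotalOrder :=
    { trichotomous := fun a b hab hba =>
        Subtype.ext (hS a.2 b.2 (le_antisymm (not_lt.1 hba) (not_lt.1 hab)))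
      irrefl := fun a => lt_irrefl a.1.1
      trans := fun a b c hab hbc => lt_trans (α := ℝ) hab hbc }
  not_aba := by
    rintro A ⟨f, hf, rfl⟩ B ⟨g, hg, rfl⟩ x hx y hy z hz hxy hyz ⟨⟨hxf, hxg⟩, ⟨hyg, hyf⟩, hzf, hzg⟩
    have hx1 : f x.1 < g x.1 := hxf.2.trans_le (not_lt.1 fun h => hxg ⟨hx, h⟩)
    have hy1 : g y.1 < f y.1 := hyg.2.trans_le (not_lt.1 fun h => hyf ⟨hy, h⟩)
    have hz1 : f z.1 < g z.1 := hzf.2.trans_le (not_lt.1 fun h => hzg ⟨hz, h⟩)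
    have hne : f ≠ g := by
      rintro rfl
      exact lt_irrefl _ hx1
    have hcont : Continuous fun t => f t - g t := by fun_prop
    -- The open intervals put one zero strictly before `y.1` and the other strictly after it.
    obtain ⟨s, hs, hs0⟩ := intermediate_value_Ioo hxy.le hcont.continuousOn
      (show (0 : ℝ) ∈ Ioo (f x.1 - g x.1) (f y.1 - g y.1) from
        ⟨sub_neg.2 hx1, sub_pos.2 hy1⟩)
    obtain ⟨t, ht, ht0⟩ := intermediate_value_Ioo' hyz.le hcont.continuousOn
      (show (0 : ℝ) ∈ Ioo (f z.1 - g z.1) (f y.1 - g y.1) from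
        ⟨sub_neg.2 hz1, sub_pos.2 hy1⟩)
    rcases hL.disjoint_or_cross f hf g hg hne with h | ⟨w, -, hw⟩
    · exact h s (sub_eq_zero.1 hs0)
    · have hst : s = t := (hw s (sub_eq_zero.1 hs0)).trans (hw t (sub_eq_zero.1 ht0)).symm
      exact (hs.2.trans ht.1).ne hst

/-! ### From ABA-free hypergraphs to arrangements. -/

/-- A finite set with a strict total order embeds into an initial segment of `ℕ`. -/
theorem Set.Finite.exists_nat_rank {α : Type*} {V : Set α} (hV : V.Finite) {r : α → α → Prop}
    (hr : IsStrictTotalOrder V (Subrel r (· ∈ V))) :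
    ∃ (n : ℕ) (k : α → ℕ), (∀ v ∈ V, k v < n) ∧ InjOn k V ∧
      ∀ u ∈ V, ∀ v ∈ V, r u v ↔ k u < k v := by
  have hirrefl : ∀ v ∈ V, ¬ r v v := fun v hv => hr.irrefl ⟨v, hv⟩
  have htrans : ∀ u ∈ V, ∀ v ∈ V, ∀ w ∈ V, r u v → r v w → r u w := fun u hu v hv w hw =>
    hr.trans ⟨u, hu⟩ ⟨v, hv⟩ ⟨w, hw⟩
  have htri : ∀ u ∈ V, ∀ v ∈ V, ¬ r u v → ¬ r v u → u = v := fun u hu v hv h1 h2 =>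
    congrArg Subtype.val (hr.trichotomous ⟨u, hu⟩ ⟨v, hv⟩ h1 h2)
  set k : α → ℕ := fun v => {u ∈ V | r u v}.ncard
  have hmono : ∀ u ∈ V, ∀ v ∈ V, r u v → k u < k v := by
    intro u hu v hv huv
    refine ncard_lt_ncard (ssubset_iff_exists.2 ⟨fun w hw => ⟨hw.1, ?_⟩, u, ⟨hu, huv⟩, ?_⟩)
      (hV.subset (sep_subset _ _))
    · exact htrans w hw.1 u hu v hv hw.2 huv
    · exact fun h => hirrefl u hu h.2
  refine ⟨V.ncard, k, fun v hv => ?_, fun u hu v hv huv => ?_, fun u hu v hv =>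
    ⟨hmono u hu v hv, fun h => ?_⟩⟩
  · exact ncard_lt_ncard (ssubset_iff_exists.2
      ⟨sep_subset _ _, v, hv, fun h => hirrefl v hv h.2⟩) hV
  · exact htri u hu v hv (fun h => (hmono u hu v hv h).ne huv)
      (fun h => (hmono v hv u hu h).ne' huv)
  · by_contra huv
    by_cases hvu : r v u
    · exact h.not_gt (hmono v hv u hu hvu)
    · exact h.ne (congrArg k (htri u hu v hv huv hvu))

theorem Hypergraph.IsABAFree.exists_aboveHypergraph {α : Type u} {H : Hypergraph α}
    {r : α → α → Prop} (hfin : H.vertexSet.Finite) (h : H.IsABAFree r) :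
    ∃ (S : Set (ℝ × ℝ)) (L : Set C(ℝ, ℝ)) (φ : α → ℝ × ℝ),
      S.Finite ∧ Set.InjOn Prod.fst S ∧ IsGraphicPseudolineArrangement L ∧
      Set.BijOn φ H.vertexSet S ∧
      (∀ u ∈ H.vertexSet, ∀ v ∈ H.vertexSet, r u v ↔ (φ u).1 < (φ v).1) ∧
      H.image φ = aboveHypergraph S L := by
  classical
  obtain ⟨n, k, hkn, hkinj, hkr⟩ := hfin.exists_nat_rank h.isStrictTotalOrder
  set lam : ℝ := 2 * n + 1
  have hlam : 0 < lam := by positivity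
  obtain ⟨d, hd, hgen⟩ := exists_coeff_subsums_generic
    (fun j : ℕ => Real.exp (-(lam * j ^ 2))) (fun j => 2 * Real.exp (-(lam * j ^ 2)))
    (fun j => (Real.exp_pos _).le) (fun j => by linarith [Real.exp_pos (-(lam * (j : ℝ) ^ 2))]) n
  have hd0 : ∀ j, 0 < d j := fun j => (Real.exp_pos _).trans (hd j).1
  -- The set of ranks of the vertices in `e`, which indexes the bumps of its curve.
  set N : Set α → Finset ℕ := fun e => (Finset.range n).filter (· ∈ k '' e)
  have hNn : ∀ e, N e ⊆ Finset.range n := fun e => Finset.filter_subset _ _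
  have hsub : ∀ {e}, e ∈ H.edgeSet → e ⊆ H.vertexSet := fun he =>
    H.subset_vertexSet_of_mem_edgeSet' he
  have hmemN : ∀ {e i}, i ∈ N e → i ∈ k '' e := fun hi => (Finset.mem_filter.1 hi).2
  have hkN : ∀ {e}, e ∈ H.edgeSet → ∀ v ∈ H.vertexSet, k v ∈ N e ↔ v ∈ e := by
    intro e he v hv
    refine ⟨fun hi => ?_, fun hve =>
      Finset.mem_filter.2 ⟨Finset.mem_range.2 (hkn v hv), mem_image_of_mem k hve⟩⟩
    obtain ⟨w, hw, hwv⟩ := hmemN hi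
    exact hkinj (hsub he hw) hv hwv ▸ hw
  have haba : ∀ e ∈ H.edgeSet, ∀ e' ∈ H.edgeSet, ∀ x y z, x < y → y < z →
      ¬ (x ∈ N e \ N e' ∧ y ∈ N e' \ N e ∧ z ∈ N e \ N e') := by
    rintro e he e' he' x y z hxy hyz ⟨hx, hy, hz⟩
    rw [Finset.mem_sdiff] at hx hy hz
    obtain ⟨u, hu, rfl⟩ := hmemN hx.1
    obtain ⟨v, hv, rfl⟩ := hmemN hy.1
    obtain ⟨w, hw, rfl⟩ := hmemN hz.1
    have hu' := hsub he hu
    have hv' := hsub he' hv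
    have hw' := hsub he hw
    rw [hkN he _ hu', hkN he' _ hu'] at hx
    rw [hkN he _ hv', hkN he' _ hv'] at hy
    rw [hkN he _ hw', hkN he' _ hw'] at hz
    exact h.not_aba e he e' he' u hu' v hv' w hw' ((hkr u hu' v hv').2 hxy)
      ((hkr v hv' w hw').2 hyz) ⟨hx, hy, hz⟩
  set φ : α → ℝ × ℝ := fun v => (k v, -1)
  have habove : ∀ e ∈ H.edgeSet,
      φ '' e = pointsAbove (φ '' H.vertexSet) (bumpCurve lam d (N e)) := by
    intro e he
    have hiff : ∀ v ∈ H.vertexSet, bumpCurve lam d (N e) (φ v).1 < (φ v).2 ↔ v ∈ e := fun v hv =>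
      (bumpCurve_natCast_lt_neg_one_iff hd (hNn e) (k v)).trans (hkN he v hv)
    ext p
    constructor
    · rintro ⟨v, hv, rfl⟩
      exact ⟨mem_image_of_mem φ (hsub he hv), (hiff v (hsub he hv)).2 hv⟩
    · rintro ⟨⟨v, hv, rfl⟩, hlt⟩
      exact mem_image_of_mem φ ((hiff v hv).1 hlt)
  have hφ1 : ∀ u v, (φ u).1 < (φ v).1 ↔ k u < k v := fun u v => Nat.cast_lt
  have hφeq : ∀ u v, (φ u).1 = (φ v).1 ↔ k u = k v := fun u v => Nat.cast_inj
  refine ⟨φ '' H.vertexSet, (fun e => bumpCurve lam d (N e)) '' H.edgeSet, φ, hfin.image φ,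
    ?_, ⟨?_, ?_, ?_⟩, ⟨mapsTo_image _ _, ?_, surjOn_image _ _⟩, fun u hu v hv => ?_, ?_⟩
  · rintro _ ⟨u, hu, rfl⟩ _ ⟨v, hv, rfl⟩ huv
    rw [hkinj hu hv ((hφeq u v).1 huv)]
  · exact (hfin.finite_subsets.subset fun e he => hsub he).image _
  · rintro _ ⟨e, he, rfl⟩ _ ⟨e', he', rfl⟩ hne
    refine bumpCurve_disjoint_or_cross hlam hd0 (fun hee => hne (by simp only [hee])) ?_
    exact Finset.sdiff_separated_of_not_aba (haba e he e' he') (haba e' he' e he)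
  · rintro _ ⟨e₁, -, rfl⟩ _ ⟨e₂, -, rfl⟩ _ ⟨e₃, -, rfl⟩ h12 h23 h13 x ⟨hx1, hx2⟩
    rcases hgen _ _ _ (hNn e₁) (hNn e₂) (hNn e₃) _ (Real.exp_pos _)
      ((bumpCurve_eq_iff ..).1 hx1) ((bumpCurve_eq_iff ..).1 hx2) with hee | hee | hee
    · exact h12 (congrArg (bumpCurve lam d) hee)
    · exact h23 (congrArg (bumpCurve lam d) hee)
    · exact h13 (congrArg (bumpCurve lam d) hee)
  · exact fun u hu v hv huv => hkinj hu hv ((hφeq u v).1 (congrArg Prod.fst huv))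
  · rw [hφ1, hkr u hu v hv]
  · refine Hypergraph.ext rfl ?_
    ext s
    constructor
    · rintro ⟨e, he, rfl⟩
      exact ⟨_, mem_image_of_mem _ he, habove e he⟩
    · rintro ⟨_, ⟨e, he, rfl⟩, rfl⟩
      exact ⟨e, he, habove e he⟩

theorem mainTheorem11 :
    (∀ (S : Set (ℝ × ℝ)) (L : Set C(ℝ, ℝ)), S.Finite → Set.InjOn Prod.fst S →
      IsGraphicPseudolineArrangement L →
      (aboveHypergraph S L).IsABAFree (fun p q => p.1 < q.1)) ∧
    (∀ (α : Type u) (H : Hypergraph α) (r : α → α → Prop), H.vertexSet.Finite → H.IsABAFree r →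
      ∃ (S : Set (ℝ × ℝ)) (L : Set C(ℝ, ℝ)) (φ : α → ℝ × ℝ),
        S.Finite ∧ Set.InjOn Prod.fst S ∧ IsGraphicPseudolineArrangement L ∧
        Set.BijOn φ H.vertexSet S ∧
        (∀ u ∈ H.vertexSet, ∀ v ∈ H.vertexSet, r u v ↔ (φ u).1 < (φ v).1) ∧
        H.image φ = aboveHypergraph S L) :=
  ⟨fun _ _ _ hS hL => aboveHypergraph_isABAFree hS hL,
    fun _ _ _ hfin h => h.exists_aboveHypergraph hfin⟩
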